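/- Let $N$ be a finite set. For jointly distributed random variables $\xi=(\xi_i)_{i\in N}$ with finite alphabets, the entropy profile of $\xi$ is the function $A\mapsto \mathbf H(\xi_A)$ on subsets $A\subseteq N$, where $\xi_A=(\xi_i)_{i\in A}$, $\mathbf H$ is the Shannon entropy (base $2$), and the value at $\emptyset$ is $0$. A function $f:2^N\to\mathbb R$ is called almost entropic (aent) if it lies in the closure, in the usual Euclidean topology, of the set of all entropy profiles on $N$. Write $f(A\,|\,B)=f(A\cup B)-f(B)$. Lemma. Suppose $f$ is aent on $N$, and $N$ is partitioned as $N = X\sqcup Y\sqcup\{z\}$ (where $X$ and $Y$ may be empty). Then there is an aent function $f^*$ on $N$ such that $$ f^*(A)=\begin{cases} f(A) & \text{if } z\notin A,\\ f(A)-f(\{z\}\,|\,Y) & \text{if } z\in A\subseteq Y\cup\{z\},\end{cases} $$ for every $A\subseteq N$ falling in one of the two cases. -/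

import Mathlib

namespace EntropyRegion

/-- Shannon entropy, in bits, of a probability mass function `p` on a finite alphabet.
The convention `0 * log 0 = 0` holds automatically. -/
noncomputable def entropy {α : Type*} [Fintype α] (p : α → ℝ) : ℝ :=
  ∑ x, -(p x * Real.logb 2 (p x))

open Classical in
/-- The marginal on the coordinates in `A` of a mass function `p` on the product of the
alphabets `X i`: the mass of `y` is the sum of the masses of those `x` that restrict to `y`. -/
noncomputable def marginal {N : Type*} [Fintype N] [DecidableEq N] {X : N → Type}
    [∀ i, Fintype (X i)] (p : (∀ i, X i) → ℝ) (A : Finset N) : (∀ i : A, X i) → ℝ :=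
  fun y => ∑ x with A.restrict x = y, p x

/-- `f` is the entropy profile of some family of jointly distributed random variables, indexed
by `N`, with finite alphabets. The coordinate at the empty set is then `0`. -/
def IsEntropic {N : Type*} [Fintype N] [DecidableEq N] (f : Finset N → ℝ) : Prop :=
  ∃ (X : N → Type) (_ : ∀ i, Fintype (X i)) (p : (∀ i, X i) → ℝ),
    p ∈ stdSimplex ℝ (∀ i, X i) ∧ ∀ A : Finset N, f A = entropy (marginal p A)

/-- `f` is almost entropic (aent): it lies in the closure of the set of entropic functions, for
the usual topology of the finite-dimensional real vector space of functions on subsets. -/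
def IsAent {N : Type*} [Fintype N] [DecidableEq N] (f : Finset N → ℝ) : Prop :=
  f ∈ closure {g : Finset N → ℝ | IsEntropic g}

/-- The conditional quantity `f(A | B) = f(A ∪ B) - f(B)`. -/
def condRank {N : Type*} [DecidableEq N] (f : Finset N → ℝ) (A B : Finset N) : ℝ :=
  f (A ∪ B) - f B

/-- Entropic functions follow the convention `f ∅ = 0`. -/
theorem IsEntropic.empty {N : Type*} [Fintype N] [DecidableEq N] {f : Finset N → ℝ}
    (hf : IsEntropic f) : f ∅ = 0 := by
  obtain ⟨X, _, p, hp, h⟩ := hf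
  have hm : ∀ y, marginal p ∅ y = 1 := by
    intro y
    have : ∀ x : ∀ i, X i, (∅ : Finset N).restrict x = y := fun x => Subsingleton.elim _ _
    simp [marginal, this, hp.2]
  simp [h, entropy, hm]

/-- Almost entropic functions follow the convention `f ∅ = 0`. -/
theorem IsAent.empty {N : Type*} [Fintype N] [DecidableEq N] {f : Finset N → ℝ}
    (hf : IsAent f) : f ∅ = 0 := by
  have hc : IsClosed {g : Finset N → ℝ | g ∅ = 0} :=
    isClosed_eq (continuous_apply ∅) continuous_const
  exact closure_minimal (fun g hg => IsEntropic.empty hg) hc hf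

end EntropyRegion

/-!
The statement is the Ahlswede–Körner lemma: `z` is replaced, in the limit, by a function of `Y` that
keeps the mutual information of `z` with every part of `Y`.

For an entropic `f`, glue two copies of the family along `Y`, taking `ξ_z` from the first copy and
everything else from the second (`Model.glue`). This changes neither the profile off `z` nor the
profile on `Y ∪ {z}`, and makes `ξ_z` conditionally independent of all other variables given `ξ_Y`,
so that `f(z | Y)` becomes the conditional entropy `h` of `ξ_z` given *all* other variables. It is
therefore enough to subtract `h` from the value at every set that contains `z`
(`Model.isAent_truncate`).

Take `n` independent copies of the family and hash `ξ_z^n` to about `2 ^ (n h)` values by a map `w`.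
For a suitable map (`exists_hash`, an average over all maps) the hash is nearly uniform given the
other variables: the deficit is at most the mean of `log (1 + M P(ξ_z^n | others))`, and as the
information `-log P(ξ_z^n | others)` has mean `n h` and variance `O(n)`, this is `O(√n)`. Hence
`H(w) = n h + O(√n)`, and `w` has mutual information `O(√n)` with any tuple not involving `z`. So the
conditional profile `H(ξ_A^n | w)` equals `n f(A)` when `z ∉ A` and `n (f(A) - h)` when `z ∈ A`, up
to `O(√n)`. Conditional profiles are convex combinations of entropy profiles, and the almost
entropic functions are closed under sums and scaling down (`IsAent.add`, `IsAent.smul`), so dividing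
by `n` and letting `n → ∞` gives the claim.

For an almost entropic `f`, approximate by entropic functions. The functions obtained for these are
monotone, and their value at the whole index set is that of the approximants off `z`, so they stay
in a compact box and a subsequence converges.
-/

namespace EntropyRegion

/-! ### Entropy of variables on a finite sample space -/

section Entropy

variable {Ω α β γ : Type*} [Fintype Ω]

open Classical in
/-- The probability, under the weights `p` on the sample space `Ω`, that the random variable `φ`
takes the value it has at `ω`. -/
noncomputable def mass (p : Ω → ℝ) (φ : Ω → α) (ω : Ω) : ℝ :=
  ∑ ω', if φ ω' = φ ω then p ω' else 0

/-- Shannon entropy of the random variable `φ` on the sample space `Ω` with weights `p`, written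
as the mean of the information `-log P(φ = φ ω)`. It depends on `φ` only through the partition
of `Ω` into level sets, so the alphabet `α` need not be finite. -/
noncomputable def ent (p : Ω → ℝ) (φ : Ω → α) : ℝ :=
  ∑ ω, p ω * -Real.logb 2 (mass p φ ω)

theorem mass_congr {p : Ω → ℝ} {φ : Ω → α} {ψ : Ω → β} {ω : Ω}
    (h : ∀ ω', p ω' ≠ 0 → (φ ω' = φ ω ↔ ψ ω' = ψ ω)) : mass p φ ω = mass p ψ ω := by
  classical
  refine Finset.sum_congr rfl fun ω' _ => ?_
  by_cases h0 : p ω' = 0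
  · simp [h0]
  · simp only [h ω' h0]

/-- Variables with the same level sets on the support of `p` have the same entropy. -/
theorem ent_congr {p : Ω → ℝ} {φ : Ω → α} {ψ : Ω → β}
    (h : ∀ ω ω', p ω ≠ 0 → p ω' ≠ 0 → (φ ω' = φ ω ↔ ψ ω' = ψ ω)) : ent p φ = ent p ψ := by
  refine Finset.sum_congr rfl fun ω _ => ?_
  by_cases h0 : p ω = 0
  · simp [h0]
  · rw [mass_congr fun ω' => h ω ω' h0]

theorem mass_nonneg {p : Ω → ℝ} (hp : ∀ ω, 0 ≤ p ω) (φ : Ω → α) (ω : Ω) : 0 ≤ mass p φ ω :=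
  Finset.sum_nonneg fun ω' _ => by split_ifs <;> simp [hp]

theorem le_mass {p : Ω → ℝ} (hp : ∀ ω, 0 ≤ p ω) (φ : Ω → α) (ω : Ω) : p ω ≤ mass p φ ω := by
  classical
  have := Finset.single_le_sum (f := fun ω' => if φ ω' = φ ω then p ω' else 0)
    (fun ω' _ => by split_ifs <;> simp [hp]) (Finset.mem_univ ω)
  simpa [mass] using this

theorem mass_pos {p : Ω → ℝ} (hp : ∀ ω, 0 ≤ p ω) (φ : Ω → α) {ω : Ω} (h : p ω ≠ 0) :
    0 < mass p φ ω :=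
  ((hp ω).lt_of_ne' h).trans_le (le_mass hp φ ω)

theorem mass_eq_of_eq {p : Ω → ℝ} {φ : Ω → α} {ω ω' : Ω} (h : φ ω = φ ω') :
    mass p φ ω = mass p φ ω' := by
  rw [mass, mass, h]

theorem mass_mono {p : Ω → ℝ} (hp : ∀ ω, 0 ≤ p ω) {φ : Ω → α} {ψ : Ω → β}
    (h : ∀ ω ω', φ ω' = φ ω → ψ ω' = ψ ω) (ω : Ω) : mass p φ ω ≤ mass p ψ ω := by
  classical
  refine Finset.sum_le_sum fun ω' _ => ?_
  by_cases h1 : φ ω' = φ ω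
  · simp [h1, h _ _ h1]
  · simp only [h1, if_false]
    split_ifs <;> simp [hp]

/-- A variable that is determined by another one has the smaller entropy. -/
theorem ent_mono {p : Ω → ℝ} (hp : ∀ ω, 0 ≤ p ω) {φ : Ω → α} {ψ : Ω → β}
    (h : ∀ ω ω', φ ω' = φ ω → ψ ω' = ψ ω) : ent p ψ ≤ ent p φ := by
  refine Finset.sum_le_sum fun ω _ => ?_
  by_cases h0 : p ω = 0
  · simp [h0]
  · refine mul_le_mul_of_nonneg_left (neg_le_neg ?_) (hp ω)
    exact Real.logb_le_logb_of_le (by norm_num) (mass_pos hp φ h0) (mass_mono hp h ω)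

theorem ent_eq_zero_of_const {p : Ω → ℝ} (hs : ∑ ω, p ω = 1) {φ : Ω → α}
    (h : ∀ ω ω', φ ω' = φ ω) : ent p φ = 0 := by
  have h1 : ∀ ω, mass p φ ω = 1 := fun ω => by
    rw [mass, ← hs]
    exact Finset.sum_congr rfl fun ω' _ => if_pos (h ω ω')
  simp [ent, h1]

/-- Gibbs' inequality. -/
theorem sum_mul_logb_nonpos {p x : Ω → ℝ} (hp : ∀ ω, 0 ≤ p ω) (hs : ∑ ω, p ω = 1)
    (hx : ∀ ω, p ω ≠ 0 → 0 < x ω) (h : ∑ ω, p ω * x ω ≤ 1) :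
    ∑ ω, p ω * Real.logb 2 (x ω) ≤ 0 := by
  have hl : 0 < Real.log 2 := Real.log_pos (by norm_num)
  calc ∑ ω, p ω * Real.logb 2 (x ω) ≤ ∑ ω, p ω * ((x ω - 1) / Real.log 2) := by
        refine Finset.sum_le_sum fun ω _ => ?_
        by_cases h0 : p ω = 0
        · simp [h0]
        · refine mul_le_mul_of_nonneg_left ?_ (hp ω)
          exact div_le_div_of_nonneg_right (Real.log_le_sub_one_of_pos (hx ω h0)) hl.le
    _ = (∑ ω, p ω * x ω - ∑ ω, p ω) / Real.log 2 := by
        rw [← Finset.sum_sub_distrib, Finset.sum_div]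
        exact Finset.sum_congr rfl fun ω _ => by ring
    _ ≤ 0 := div_nonpos_of_nonpos_of_nonneg (by linarith) hl.le

/-- The weights in one level set of `φ`, divided by the mass of that set, add up to one, or to
zero if the level set is null. -/
theorem sum_div_mass_le_one {p : Ω → ℝ} (hp : ∀ ω, 0 ≤ p ω) (φ : Ω → α) (s : Finset Ω)
    (h : ∀ ω ∈ s, ∀ ω' ∈ s, φ ω = φ ω') : ∑ ω ∈ s, p ω / mass p φ ω ≤ 1 := by
  classical
  rcases s.eq_empty_or_nonempty with rfl | ⟨ω₀, h₀⟩
  · simp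
  rw [Finset.sum_congr rfl fun ω hω => by rw [mass_eq_of_eq (p := p) (h ω hω ω₀ h₀)],
    ← Finset.sum_div]
  refine div_le_one_of_le₀ ?_ (mass_nonneg hp _ _)
  rw [mass, ← Finset.sum_filter]
  refine Finset.sum_le_sum_of_subset_of_nonneg (fun ω hω => ?_) fun ω _ _ => hp ω
  simp [h ω hω ω₀ h₀]

/-- Entropy is at most the logarithm of the size of the alphabet. -/
theorem ent_le_logb_card [Fintype α] [Nonempty α] {p : Ω → ℝ} (hp : ∀ ω, 0 ≤ p ω)
    (hs : ∑ ω, p ω = 1) (φ : Ω → α) : ent p φ ≤ Real.logb 2 (Fintype.card α) := by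
  classical
  have hc : (0 : ℝ) < Fintype.card α := by exact_mod_cast Fintype.card_pos
  have key := sum_mul_logb_nonpos (x := fun ω => 1 / mass p φ ω / Fintype.card α) hp hs
    (fun ω h0 => div_pos (one_div_pos.2 (mass_pos hp φ h0)) hc) (by
      have h1 : ∑ ω, p ω * (1 / mass p φ ω / Fintype.card α)
          = (∑ a : α, ∑ ω with φ ω = a, p ω / mass p φ ω) / Fintype.card α := by
        rw [Finset.sum_fiberwise (s := Finset.univ) (g := φ) (f := fun ω => p ω / mass p φ ω),
            Finset.sum_div]
        exact Finset.sum_congr rfl fun ω _ => by ring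
      rw [h1, div_le_one hc]
      calc _ ≤ ∑ _a : α, (1 : ℝ) := Finset.sum_le_sum fun a _ =>
            sum_div_mass_le_one hp φ _ fun ω hω ω' hω' => by simp_all
        _ = _ := by simp)
  have h2 : ∑ ω, p ω * Real.logb 2 (1 / mass p φ ω / Fintype.card α)
      = ent p φ - (∑ ω, p ω) * Real.logb 2 (Fintype.card α) := by
    rw [ent, Finset.sum_mul, ← Finset.sum_sub_distrib]
    refine Finset.sum_congr rfl fun ω _ => ?_
    by_cases h0 : p ω = 0
    · simp [h0]
    · have := mass_pos hp φ h0
      rw [Real.logb_div (by positivity) hc.ne', one_div, Real.logb_inv]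
      ring
  rw [h2, hs] at key
  linarith

/-- Submodularity: conditioning on more, from `φ` to the finer variable `ψ`, decreases the
conditional entropy of `w`. -/
theorem condEnt_antitone {p : Ω → ℝ} (hp : ∀ ω, 0 ≤ p ω) (hs : ∑ ω, p ω = 1)
    {φ : Ω → α} {ψ : Ω → β} (w : Ω → γ) (h : ∀ ω ω', ψ ω' = ψ ω → φ ω' = φ ω) :
    ent p (fun ω => (ψ ω, w ω)) - ent p ψ ≤ ent p (fun ω => (φ ω, w ω)) - ent p φ := by
  classical
  set P := mass p φ with hP
  set Q := mass p ψ with hQ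
  set Pw := mass p (fun ω => (φ ω, w ω)) with hPw
  set Qw := mass p (fun ω => (ψ ω, w ω)) with hQw
  have hpos : ∀ ω, p ω ≠ 0 → 0 < P ω ∧ 0 < Q ω ∧ 0 < Pw ω ∧ 0 < Qw ω := fun ω h0 =>
    ⟨mass_pos hp _ h0, mass_pos hp _ h0, mass_pos hp _ h0, mass_pos hp _ h0⟩
  -- For every `ω'`, the mass of `Q / Qw` in the `(φ, w)`-level set of `ω'` is at most `P ω'`.
  have inner : ∀ ω', ∑ ω, (if (φ ω', w ω') = (φ ω, w ω) then p ω / Qw ω * Q ω else 0) ≤ P ω' := by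
    intro ω'
    calc _ = ∑ ω, ∑ ω'', (if (φ ω', w ω') = (φ ω, w ω) ∧ ψ ω'' = ψ ω
              then p ω'' * (p ω / Qw ω) else 0) := by
          refine Finset.sum_congr rfl fun ω _ => ?_
          by_cases h1 : (φ ω', w ω') = (φ ω, w ω)
          · rw [if_pos h1, hQ, mass, Finset.mul_sum]
            refine Finset.sum_congr rfl fun ω'' _ => ?_
            by_cases h2 : ψ ω'' = ψ ω <;> simp [h1, h2, mul_comm]
          · simp [h1]
      _ = ∑ ω'', ∑ ω, (if (φ ω', w ω') = (φ ω, w ω) ∧ ψ ω'' = ψ ω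
              then p ω'' * (p ω / Qw ω) else 0) := Finset.sum_comm
      _ ≤ P ω' := by
          refine Finset.sum_le_sum fun ω'' _ => ?_
          by_cases h1 : φ ω'' = φ ω'
          · rw [if_pos h1, ← Finset.sum_filter, ← Finset.mul_sum]
            refine mul_le_of_le_one_right (hp ω'') (sum_div_mass_le_one hp _ _ ?_)
            intro ω hω ω₁ hω₁
            simp only [Finset.mem_filter, Finset.mem_univ, true_and, Prod.mk.injEq] at hω hω₁ ⊢
            exact ⟨hω.2.symm.trans hω₁.2, hω.1.2.symm.trans hω₁.1.2⟩
          · rw [if_neg h1]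
            refine (Finset.sum_eq_zero fun ω _ => if_neg ?_).le
            rintro ⟨h2, h3⟩
            exact h1 ((h _ _ h3).trans (Prod.mk.inj h2).1.symm)
  have tot : ∑ ω, p ω * (Pw ω * Q ω / (P ω * Qw ω)) ≤ 1 := by
    calc _ = ∑ ω, ∑ ω', (if (φ ω', w ω') = (φ ω, w ω)
              then p ω' / P ω' * (p ω / Qw ω * Q ω) else 0) := by
          refine Finset.sum_congr rfl fun ω _ => ?_
          have : p ω * (Pw ω * Q ω / (P ω * Qw ω))
              = Pw ω * (p ω / Qw ω * Q ω / P ω) := by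
            simp only [div_eq_mul_inv, mul_inv]; ring
          rw [this, hPw, mass, Finset.sum_mul]
          refine Finset.sum_congr rfl fun ω' _ => ?_
          by_cases h1 : (φ ω', w ω') = (φ ω, w ω)
          · rw [if_pos h1, if_pos h1, hP, mass_eq_of_eq (Prod.mk.inj h1).1]
            ring
          · simp [h1]
      _ = ∑ ω', p ω' / P ω' *
            ∑ ω, (if (φ ω', w ω') = (φ ω, w ω) then p ω / Qw ω * Q ω else 0) := by
          rw [Finset.sum_comm]
          refine Finset.sum_congr rfl fun ω' _ => ?_
          rw [Finset.mul_sum]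
          exact Finset.sum_congr rfl fun ω _ => by simp
      _ ≤ ∑ ω', p ω' := by
          refine Finset.sum_le_sum fun ω' _ => ?_
          by_cases h0 : p ω' = 0
          · simp [h0]
          · have hp' := (hpos ω' h0).1
            calc _ ≤ p ω' / P ω' * P ω' :=
                  mul_le_mul_of_nonneg_left (inner ω') (div_nonneg (hp _) hp'.le)
              _ = p ω' := div_mul_cancel₀ _ hp'.ne'
      _ = 1 := hs
  have key := sum_mul_logb_nonpos hp hs (x := fun ω => Pw ω * Q ω / (P ω * Qw ω))
    (fun ω h0 => by obtain ⟨h1, h2, h3, h4⟩ := hpos ω h0; positivity) tot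
  have h2 : ∑ ω, p ω * Real.logb 2 (Pw ω * Q ω / (P ω * Qw ω))
      = ent p (fun ω => (ψ ω, w ω)) - ent p ψ - (ent p (fun ω => (φ ω, w ω)) - ent p φ) := by
    simp only [ent, ← Finset.sum_sub_distrib]
    refine Finset.sum_congr rfl fun ω _ => ?_
    by_cases h0 : p ω = 0
    · simp [h0]
    · obtain ⟨h1, h2, h3, h4⟩ := hpos ω h0
      rw [Real.logb_div (by positivity) (by positivity), Real.logb_mul h3.ne' h2.ne',
        Real.logb_mul h1.ne' h4.ne']
      ring
  linarith

theorem ent_pair_le {p : Ω → ℝ} (hp : ∀ ω, 0 ≤ p ω) (hs : ∑ ω, p ω = 1)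
    (φ : Ω → α) (w : Ω → γ) : ent p (fun ω => (φ ω, w ω)) ≤ ent p φ + ent p w := by
  have h := condEnt_antitone hp hs (φ := fun _ => ()) (ψ := φ) w fun _ _ _ => rfl
  rw [ent_eq_zero_of_const (φ := fun _ => ()) hs fun _ _ => rfl,
    ent_congr (φ := fun ω => ((), w ω)) (ψ := w) (by simp)] at h
  linarith

/-- If `π` carries the weights `q` to `p`, then the masses for `φ ∘ π` and for `φ` agree. -/
theorem mass_comp {Ω' : Type*} [Fintype Ω'] [DecidableEq Ω] {q : Ω' → ℝ} {p : Ω → ℝ} {π : Ω' → Ω}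
    (h : ∀ ω, ∑ ω' with π ω' = ω, q ω' = p ω) (φ : Ω → α) (ω' : Ω') :
    mass q (φ ∘ π) ω' = mass p φ (π ω') := by
  classical
  rw [mass, mass, ← Finset.sum_fiberwise _ π]
  refine Finset.sum_congr rfl fun ω _ => ?_
  rw [← h ω]
  by_cases h1 : φ ω = φ (π ω')
  · rw [if_pos h1]
    exact Finset.sum_congr rfl fun ω₁ h₁ => if_pos (by simp_all)
  · rw [if_neg h1]
    exact Finset.sum_eq_zero fun ω₁ h₁ => if_neg (by simp_all)

theorem sum_comp {Ω' : Type*} [Fintype Ω'] [DecidableEq Ω] {q : Ω' → ℝ} {p : Ω → ℝ} {π : Ω' → Ω}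
    (h : ∀ ω, ∑ ω' with π ω' = ω, q ω' = p ω) (F : Ω → ℝ) :
    ∑ ω', q ω' * F (π ω') = ∑ ω, p ω * F ω := by
  rw [← Finset.sum_fiberwise _ π]
  refine Finset.sum_congr rfl fun ω _ => ?_
  rw [← h ω, Finset.sum_mul]
  exact Finset.sum_congr rfl fun ω₁ h₁ => by simp_all

theorem ent_comp {Ω' : Type*} [Fintype Ω'] [DecidableEq Ω] {q : Ω' → ℝ} {p : Ω → ℝ} {π : Ω' → Ω}
    (h : ∀ ω, ∑ ω' with π ω' = ω, q ω' = p ω) (φ : Ω → α) : ent q (φ ∘ π) = ent p φ := by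
  simp only [ent, mass_comp h]
  exact sum_comp h fun ω => -Real.logb 2 (mass p φ ω)

/-- Under a product of weights, masses of pairs of variables multiply. -/
theorem mass_prod {Ω' : Type*} [Fintype Ω'] (p : Ω → ℝ) (q : Ω' → ℝ) (φ : Ω → α) (ψ : Ω' → β)
    (ω : Ω × Ω') : mass (fun x : Ω × Ω' => p x.1 * q x.2) (fun x => (φ x.1, ψ x.2)) ω
      = mass p φ ω.1 * mass q ψ ω.2 := by
  classical
  rw [mass, mass, mass, Finset.sum_mul_sum, ← Finset.univ_product_univ, Finset.sum_product]
  refine Finset.sum_congr rfl fun ω₁ _ => Finset.sum_congr rfl fun ω₂ _ => ?_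
  by_cases h1 : φ ω₁ = φ ω.1 <;> by_cases h2 : ψ ω₂ = ψ ω.2 <;> simp [h1, h2]

theorem sum_prod_mul_add {Ω' : Type*} [Fintype Ω'] {p : Ω → ℝ} {q : Ω' → ℝ}
    (hp : ∑ ω, p ω = 1) (hq : ∑ ω, q ω = 1) (F : Ω → ℝ) (G : Ω' → ℝ) :
    ∑ x : Ω × Ω', p x.1 * q x.2 * (F x.1 + G x.2) = ∑ ω, p ω * F ω + ∑ ω, q ω * G ω := by
  have h : ∀ x : Ω × Ω', p x.1 * q x.2 * (F x.1 + G x.2)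
      = p x.1 * F x.1 * q x.2 + p x.1 * (q x.2 * G x.2) := fun x => by ring
  simp only [h, Finset.sum_add_distrib, Fintype.sum_prod_type, ← Finset.mul_sum, ← Finset.sum_mul,
    hp, hq, mul_one, one_mul]

/-- Variances of independent centred variables add. -/
theorem sum_prod_mul_add_sq {Ω' : Type*} [Fintype Ω'] {p : Ω → ℝ} {q : Ω' → ℝ}
    (hp : ∑ ω, p ω = 1) (hq : ∑ ω, q ω = 1) {F : Ω → ℝ} (hF : ∑ ω, p ω * F ω = 0) (G : Ω' → ℝ) :
    ∑ x : Ω × Ω', p x.1 * q x.2 * (F x.1 + G x.2) ^ 2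
      = ∑ ω, p ω * F ω ^ 2 + ∑ ω, q ω * G ω ^ 2 := by
  have h : ∀ x : Ω × Ω', p x.1 * q x.2 * (F x.1 + G x.2) ^ 2
      = p x.1 * F x.1 ^ 2 * q x.2 + p x.1 * (q x.2 * G x.2 ^ 2)
        + p x.1 * F x.1 * (2 * (q x.2 * G x.2)) := fun x => by ring
  simp only [h, Finset.sum_add_distrib, Fintype.sum_prod_type, ← Finset.mul_sum, ← Finset.sum_mul,
    hp, hq, hF, mul_one, one_mul, zero_mul, add_zero]

/-- Entropies of independent variables add. -/
theorem ent_prod {Ω' : Type*} [Fintype Ω'] {p : Ω → ℝ} {q : Ω' → ℝ}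
    (hp : ∀ ω, 0 ≤ p ω) (hps : ∑ ω, p ω = 1) (hq : ∀ ω, 0 ≤ q ω) (hqs : ∑ ω, q ω = 1)
    (φ : Ω → α) (ψ : Ω' → β) :
    ent (fun x : Ω × Ω' => p x.1 * q x.2) (fun x => (φ x.1, ψ x.2)) = ent p φ + ent q ψ := by
  rw [ent, ent, ent, ← sum_prod_mul_add hps hqs]
  refine Finset.sum_congr rfl fun x _ => ?_
  by_cases h1 : p x.1 = 0
  · simp [h1]
  by_cases h2 : q x.2 = 0
  · simp [h2]
  rw [mass_prod, Real.logb_mul (mass_pos hp φ h1).ne' (mass_pos hq ψ h2).ne', neg_add]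

end Entropy

/-! ### Families of random variables and the cone of almost entropic functions -/

section Models

universe u

/-- A finite family of jointly distributed random variables `ξ i`, each with a finite alphabet
`X i`, on a finite sample space `Ω` with probability weights `p`. The sample space lives in the
universe of the index set so that it may be the product of all alphabets. -/
structure Model (N : Type u) where
  Ω : Type u
  [fintypeΩ : Fintype Ω]
  p : Ω → ℝ
  nonneg : ∀ ω, 0 ≤ p ω
  sum_eq : ∑ ω, p ω = 1
  X : N → Type
  [fintypeX : ∀ i, Fintype (X i)]
  ξ : ∀ i, Ω → X i

attribute [instance] Model.fintypeΩ Model.fintypeX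

namespace Model

variable {N : Type u}

/-- The joint variable `ξ_A`. -/
def vars (m : Model N) (A : Finset N) (ω : m.Ω) : ∀ i : A, m.X i := fun i => m.ξ i ω

theorem vars_eq_iff (m : Model N) {A : Finset N} {ω ω' : m.Ω} :
    m.vars A ω = m.vars A ω' ↔ ∀ i ∈ A, m.ξ i ω = m.ξ i ω' := by
  simp [vars, funext_iff]

/-- The entropy profile of the family. -/
noncomputable def profile (m : Model N) (A : Finset N) : ℝ := ent m.p (m.vars A)

theorem profile_mono (m : Model N) {A B : Finset N} (h : A ⊆ B) : m.profile A ≤ m.profile B :=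
  ent_mono m.nonneg fun ω ω' => by
    simp only [vars_eq_iff]
    exact fun h' i hi => h' i (h hi)

theorem profile_empty (m : Model N) : m.profile ∅ = 0 :=
  ent_eq_zero_of_const m.sum_eq fun _ _ => Subsingleton.elim _ _

/-- Two independent families, paired index by index. -/
def prod (m m' : Model N) : Model N where
  Ω := m.Ω × m'.Ω
  p x := m.p x.1 * m'.p x.2
  nonneg x := mul_nonneg (m.nonneg _) (m'.nonneg _)
  sum_eq := by
    rw [Fintype.sum_prod_type, ← Finset.sum_mul_sum, m.sum_eq, m'.sum_eq, one_mul]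
  X i := m.X i × m'.X i
  ξ i x := (m.ξ i x.1, m'.ξ i x.2)

theorem prod_vars_eq_iff (m m' : Model N) {A : Finset N} {x y : (m.prod m').Ω} :
    (m.prod m').vars A x = (m.prod m').vars A y ↔
      (m.vars A x.1, m'.vars A x.2) = (m.vars A y.1, m'.vars A y.2) := by
  rw [Prod.mk.injEq, vars_eq_iff, vars_eq_iff, vars_eq_iff]
  simp only [prod, Prod.mk.injEq]
  exact ⟨fun h => ⟨fun i hi => (h i hi).1, fun i hi => (h i hi).2⟩,
    fun h i hi => ⟨h.1 i hi, h.2 i hi⟩⟩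

theorem profile_prod (m m' : Model N) (A : Finset N) :
    (m.prod m').profile A = m.profile A + m'.profile A := by
  rw [profile, profile, profile,
    ← ent_prod m.nonneg m.sum_eq m'.nonneg m'.sum_eq (m.vars A) (m'.vars A)]
  exact ent_congr fun x y _ _ => prod_vars_eq_iff m m'

/-- With probability `1 - δ` the whole family is erased, otherwise it is left as it is. -/
def mask (m : Model N) (δ : ℝ) (h0 : 0 ≤ δ) (h1 : δ ≤ 1) : Model N where
  Ω := Option m.Ω
  p x := x.elim (1 - δ) fun ω => δ * m.p ω
  nonneg x := by
    cases x
    · simpa using h1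
    · exact mul_nonneg h0 (m.nonneg _)
  sum_eq := by
    simp [Fintype.sum_option, ← Finset.mul_sum, m.sum_eq]
  X i := Option (m.X i)
  ξ i := Option.map (m.ξ i)

theorem profile_mask (m : Model N) {δ : ℝ} (h0 : 0 ≤ δ) (h1 : δ ≤ 1) {A : Finset N}
    (hA : A.Nonempty) :
    (m.mask δ h0 h1).profile A = δ * m.profile A + Real.binEntropy δ / Real.log 2 := by
  classical
  obtain ⟨i, hi⟩ := hA
  have hn : mass (m.mask δ h0 h1).p ((m.mask δ h0 h1).vars A) (none : Option m.Ω) = 1 - δ := by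
    refine (Fintype.sum_option _).trans ?_
    rw [if_pos rfl, Finset.sum_eq_zero, add_zero]
    · rfl
    · intro ω _
      refine if_neg fun h => ?_
      have := (vars_eq_iff _).1 h i hi
      simp [mask] at this
  have hs : ∀ ω : m.Ω, mass (m.mask δ h0 h1).p ((m.mask δ h0 h1).vars A) (some ω : Option m.Ω)
      = δ * mass m.p (m.vars A) ω := by
    intro ω
    refine (Fintype.sum_option _).trans ?_
    rw [if_neg, zero_add, mass, Finset.mul_sum]
    · refine Finset.sum_congr rfl fun ω' _ => ?_
      have : (m.mask δ h0 h1).vars A (some ω' : Option m.Ω)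
          = (m.mask δ h0 h1).vars A (some ω : Option m.Ω) ↔ m.vars A ω' = m.vars A ω := by
        simp [vars_eq_iff, mask]
      simp only [this, mul_ite, mul_zero]
      rfl
    · intro h
      have := (vars_eq_iff _).1 h i hi
      simp [mask] at this
  have e : (m.mask δ h0 h1).profile A = (1 - δ) * -Real.logb 2 (1 - δ)
      + ∑ ω, δ * m.p ω * -Real.logb 2 (δ * mass m.p (m.vars A) ω) := by
    refine (Fintype.sum_option _).trans ?_
    rw [hn]
    simp only [hs]
    rfl
  -- Here `δ = 0` is harmless, as then every summand vanishes.
  have e2 : ∑ ω, δ * m.p ω * -Real.logb 2 (δ * mass m.p (m.vars A) ω)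
      = δ * m.profile A + (∑ ω, m.p ω) * (δ * -Real.logb 2 δ) := by
    rw [profile, ent, Finset.mul_sum, Finset.sum_mul, ← Finset.sum_add_distrib]
    refine Finset.sum_congr rfl fun ω _ => ?_
    rcases h0.eq_or_lt with rfl | hδ
    · simp
    by_cases hω : m.p ω = 0
    · simp [hω]
    rw [Real.logb_mul hδ.ne' (mass_pos m.nonneg _ hω).ne']
    ring
  rw [e, e2, m.sum_eq, Real.binEntropy, Real.logb, Real.logb, Real.log_inv, Real.log_inv]
  ring

end Model

variable {N : Type u} [Fintype N] [DecidableEq N]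

open Classical in
/-- The entropy of the law of `φ`, a sum over the alphabet, is the mean information over the sample
space. -/
theorem entropy_map_eq_ent {Ω β : Type*} [Fintype Ω] [Fintype β] (p : Ω → ℝ) (φ : Ω → β) :
    entropy (fun y => ∑ ω with φ ω = y, p ω) = ent p φ := by
  rw [entropy, ent, ← Finset.sum_fiberwise _ φ]
  refine Finset.sum_congr rfl fun y _ => ?_
  rw [← mul_neg, Finset.sum_mul]
  refine Finset.sum_congr rfl fun ω hω => ?_
  have h : φ ω = y := by simpa using hω
  rw [mass, ← Finset.sum_filter, h]

theorem entropy_marginal {X : N → Type} [∀ i, Fintype (X i)] (p : (∀ i, X i) → ℝ)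
    (A : Finset N) : entropy (marginal p A) = ent p A.restrict := by
  rw [← entropy_map_eq_ent]
  unfold marginal
  congr!

/-- Families on an arbitrary sample space give the same profiles as families of coordinates on the
product of the alphabets. -/
theorem isEntropic_iff_exists_model {f : Finset N → ℝ} :
    IsEntropic f ↔ ∃ m : Model N, m.profile = f := by
  classical
  constructor
  · rintro ⟨X, _, p, hp, h⟩
    refine ⟨{ Ω := ∀ i, X i, p := p, nonneg := hp.1, sum_eq := hp.2, X := X,
              ξ := fun i x => x i }, funext fun A => ?_⟩
    rw [h A]
    exact (entropy_marginal p A).symm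
  · rintro ⟨m, rfl⟩
    let π : m.Ω → ∀ i, m.X i := fun ω i => m.ξ i ω
    refine ⟨m.X, inferInstance, fun x => ∑ ω with π ω = x, m.p ω, ⟨fun x => ?_, ?_⟩, fun A => ?_⟩
    · exact Finset.sum_nonneg fun ω _ => m.nonneg ω
    · rw [Finset.sum_fiberwise, m.sum_eq]
    · rw [entropy_marginal]
      exact (ent_comp (π := π) (q := m.p) (fun _ => rfl) A.restrict)

theorem Model.isEntropic (m : Model N) : IsEntropic m.profile :=
  isEntropic_iff_exists_model.2 ⟨m, rfl⟩

theorem Model.isAent (m : Model N) : IsAent m.profile := subset_closure m.isEntropic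

theorem IsEntropic.add {f g : Finset N → ℝ} (hf : IsEntropic f) (hg : IsEntropic g) :
    IsEntropic (f + g) := by
  obtain ⟨m, rfl⟩ := isEntropic_iff_exists_model.1 hf
  obtain ⟨m', rfl⟩ := isEntropic_iff_exists_model.1 hg
  exact isEntropic_iff_exists_model.2 ⟨m.prod m', funext (m.profile_prod m')⟩

theorem IsAent.add {f g : Finset N → ℝ} (hf : IsAent f) (hg : IsAent g) : IsAent (f + g) :=
  map_mem_closure₂ continuous_add hf hg fun _ h₁ _ h₂ => IsEntropic.add h₁ h₂

theorem IsEntropic.succ_mul {f : Finset N → ℝ} (hf : IsEntropic f) (k : ℕ) :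
    IsEntropic (((k : ℝ) + 1) • f) := by
  induction k with
  | zero => simpa using hf
  | succ k ih =>
    have h : (((k + 1 : ℕ) : ℝ) + 1) • f = ((k : ℝ) + 1) • f + f := by
      rw [Nat.cast_succ, add_smul _ 1, one_smul]
    rw [h]
    exact ih.add hf

/-- The almost entropic functions are closed under scaling down. The multiple `c • f` is
approached by masking `k` independent copies of the family with probability `1 - c / k`: the
entropy of the mask itself tends to zero. -/
theorem IsAent.smul {f : Finset N → ℝ} (hf : IsAent f) {c : ℝ} (h0 : 0 ≤ c) (h1 : c ≤ 1) :
    IsAent (c • f) := by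
  have key : ∀ g ∈ {g : Finset N → ℝ | IsEntropic g}, c • g ∈ closure {g | IsEntropic g} := by
    intro g hg
    choose m hm using fun k => isEntropic_iff_exists_model.1 (IsEntropic.succ_mul hg k)
    have hk : ∀ k : ℕ, (0 : ℝ) < (k : ℝ) + 1 := fun k => by positivity
    have hδ1 : ∀ k : ℕ, c / ((k : ℝ) + 1) ≤ 1 := fun k =>
      (div_le_one (hk k)).2 (h1.trans (by simp))
    let g' : ℕ → Finset N → ℝ := fun k =>
      ((m k).mask (c / ((k : ℝ) + 1)) (div_nonneg h0 (hk k).le) (hδ1 k)).profile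
    refine mem_closure_of_tendsto (f := g') (b := Filter.atTop) ?_
      (Filter.Eventually.of_forall fun k => Model.isEntropic _)
    refine tendsto_pi_nhds.2 fun A => ?_
    rcases A.eq_empty_or_nonempty with rfl | hA
    · have : ∀ k, g' k ∅ = 0 := fun k => Model.profile_empty _
      simp [this, IsEntropic.empty hg]
    · have e : ∀ k, g' k A
          = c * g A + Real.binEntropy (c / ((k : ℝ) + 1)) / Real.log 2 := by
        intro k
        have := (hk k).ne'
        simp only [g', Model.profile_mask _ _ _ hA, hm, Pi.smul_apply, smul_eq_mul]
        field_simp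
      simp only [e]
      have hlim : Filter.Tendsto (fun k : ℕ => c / ((k : ℝ) + 1)) Filter.atTop (nhds 0) :=
        tendsto_const_nhds.div_atTop
          (Filter.tendsto_atTop_add_const_right _ _ tendsto_natCast_atTop_atTop)
      have := (((Real.binEntropy_continuous.tendsto 0).comp hlim).div_const
        (Real.log 2)).const_add (c * g A)
      simpa using this
  exact (closure_minimal (t := (fun g => c • g) ⁻¹' closure {g | IsEntropic g}) key
    (isClosed_closure.preimage (continuous_const_smul c))) hf

theorem IsAent.sum {ι : Type*} (s : Finset ι) {f : ι → Finset N → ℝ}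
    (h : ∀ i ∈ s, IsAent (f i)) : IsAent (∑ i ∈ s, f i) := by
  classical
  induction s using Finset.induction_on with
  | empty =>
    let m : Model N := { Ω := PUnit, p := fun _ => 1, nonneg := by simp, sum_eq := by simp,
                         X := fun _ => Unit, ξ := fun _ _ => () }
    have h0 : m.profile = 0 :=
      funext fun A => ent_eq_zero_of_const m.sum_eq fun _ _ => rfl
    rw [Finset.sum_empty, ← h0]
    exact m.isAent
  | insert a s ha ih =>
    rw [Finset.sum_insert ha]
    exact (h a (by simp)).add (ih fun i hi => h i (by simp [hi]))

open Classical in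
/-- The family conditioned on the event `w = a`, on the same sample space. -/
noncomputable def Model.cond {β : Type*} (m : Model N) (w : m.Ω → β) (a : β)
    (h : ∑ ω with w ω = a, m.p ω ≠ 0) : Model N where
  Ω := m.Ω
  p ω := (if w ω = a then m.p ω else 0) / ∑ ω with w ω = a, m.p ω
  nonneg ω := div_nonneg (by split_ifs <;> simp [m.nonneg])
    (Finset.sum_nonneg fun ω _ => m.nonneg ω)
  sum_eq := by rw [← Finset.sum_div, ← Finset.sum_filter, div_self h]
  X := m.X
  ξ := m.ξ

/-- The conditional entropy profile given a variable `w` is almost entropic, being a convex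
combination of the profiles of the conditioned families. -/
theorem Model.isAent_cond {β : Type*} [Fintype β] (m : Model N) (w : m.Ω → β) :
    IsAent fun A => ent m.p (fun ω => (m.vars A ω, w ω)) - ent m.p w := by
  classical
  let P : β → ℝ := fun a => ∑ ω with w ω = a, m.p ω
  let g : β → Finset N → ℝ := fun a => if h : P a ≠ 0 then P a • (m.cond w a h).profile else 0
  have hP : ∀ a, 0 ≤ P a := fun a => Finset.sum_nonneg fun ω _ => m.nonneg ω
  have hP1 : ∀ a, P a ≤ 1 := fun a => by
    rw [← m.sum_eq]
    exact Finset.sum_le_sum_of_subset_of_nonneg (Finset.filter_subset _ _) fun ω _ _ => m.nonneg ω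
  have hg : IsAent (∑ a, g a) := by
    refine IsAent.sum _ fun a _ => ?_
    by_cases h : P a ≠ 0
    · simp only [g, dif_pos h]
      exact (Model.isAent _).smul (hP a) (hP1 a)
    · simp only [g, dif_neg h]
      simpa using IsAent.sum (N := N) (∅ : Finset ℕ) (f := fun _ => 0) (by simp)
  convert hg using 1
  funext A
  rw [Finset.sum_apply, ent, ent, ← Finset.sum_sub_distrib, ← Finset.sum_fiberwise _ w]
  refine Finset.sum_congr rfl fun a _ => ?_
  have hmw : ∀ ω, w ω = a → mass m.p w ω = P a := fun ω hω => by
    rw [mass, ← Finset.sum_filter, hω]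
  by_cases h : P a ≠ 0
  · simp only [g, dif_pos h, Pi.smul_apply, smul_eq_mul, Model.profile, ent, Finset.mul_sum]
    rw [Finset.sum_filter]
    refine Finset.sum_congr rfl fun (ω : m.Ω) _ => ?_
    change _ = P a * ((if w ω = a then m.p ω else 0) / P a * -Real.logb 2
      (mass (m.cond w a h).p (m.vars A) ω))
    by_cases hω : w ω = a
    · rw [if_pos hω, if_pos hω, hmw ω hω]
      by_cases h0 : m.p ω = 0
      · simp [h0]
      have hmass : mass (m.cond w a h).p (m.vars A) ω
          = mass m.p (fun ω => (m.vars A ω, w ω)) ω / P a := by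
        rw [mass, Finset.sum_div]
        refine Finset.sum_congr rfl fun ω' _ => ?_
        have hp : (m.cond w a h).p ω' = (if w ω' = a then m.p ω' else 0) / P a := rfl
        rw [hp]
        by_cases h2 : w ω' = a <;> by_cases h3 : m.vars A ω' = m.vars A ω <;>
          simp [h2, h3, hω]
      rw [hmass, Real.logb_div (mass_pos m.nonneg _ h0).ne' h]
      field_simp
      ring
    · simp [hω]
  · simp only [g, dif_neg h]
    refine Finset.sum_eq_zero fun ω hω => ?_
    have hω : w ω = a := by simpa using hω
    have h0 : m.p ω = 0 :=
      le_antisymm ((le_mass m.nonneg w ω).trans_eq ((hmw ω hω).trans (not_not.1 h))) (m.nonneg ω)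
    simp [h0]

end Models

/-! ### Random hashing and removal of the conditional entropy of one variable -/

section Hash

/-- A uniformly random map `β → Fin M` identifies two distinct points with probability at
most `1 / M`. -/
theorem card_collision_le {β : Type*} [Fintype β] [DecidableEq β] (M : ℕ) {a b : β} (h : a ≠ b) :
    Fintype.card {g : β → Fin M // g a = g b} * M ≤ Fintype.card (β → Fin M) := by
  have := Fintype.card_le_of_injective
    (fun x : {g : β → Fin M // g a = g b} × Fin M => Function.update x.1.1 a x.2) (by
      rintro ⟨⟨g, hg⟩, c⟩ ⟨⟨g', hg'⟩, c'⟩ he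
      have hc : ∀ i, Function.update g a c i = Function.update g' a c' i := congrFun he
      have hcc : c = c' := by simpa using hc a
      have hne : ∀ i, i ≠ a → g i = g' i := fun i hi => by simpa [hi] using hc i
      subst hcc
      refine Prod.ext (Subtype.ext (funext fun i => ?_)) rfl
      by_cases hi : i = a
      · subst hi
        exact hg.trans ((hne b h.symm).trans hg'.symm)
      · exact hne i hi)
  simpa [Fintype.card_prod] using this

/-- Random hashing: some map `g` compresses `Z` to `M` values in such a way that, given `V`, the
hash `g Z` is nearly uniform. The bound is the mean over all `g` of the conditional divergence
of the hash from the uniform distribution, estimated by Jensen's inequality. -/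
theorem exists_hash {Ω β γ : Type*} [Fintype Ω] [Fintype β] {p : Ω → ℝ} (hp : ∀ ω, 0 ≤ p ω)
    (hs : ∑ ω, p ω = 1) (V : Ω → γ) (Z : Ω → β) (M : ℕ) [NeZero M] :
    ∃ g : β → Fin M,
      Real.logb 2 M - (ent p (fun ω => (V ω, g (Z ω))) - ent p V) ≤
        ∑ ω, p ω * Real.logb 2 (1 + M * (mass p (fun ω => (V ω, Z ω)) ω / mass p V ω)) := by
  classical
  have hM : (0 : ℝ) < M := by exact_mod_cast Nat.pos_of_ne_zero (NeZero.ne M)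
  have hG : (0 : ℝ) < Fintype.card (β → Fin M) := by exact_mod_cast Fintype.card_pos
  set G : ℝ := ((Fintype.card (β → Fin M) : ℕ) : ℝ) with hGdef
  have hD : ∀ g : β → Fin M, Real.logb 2 M - (ent p (fun ω => (V ω, g (Z ω))) - ent p V)
      = ∑ ω, p ω * Real.logb 2 (M * mass p (fun ω => (V ω, g (Z ω))) ω / mass p V ω) := by
    intro g
    have : Real.logb 2 M = ∑ ω, p ω * Real.logb 2 M := by rw [← Finset.sum_mul, hs, one_mul]
    rw [this, ent, ent, ← Finset.sum_sub_distrib, ← Finset.sum_sub_distrib]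
    refine Finset.sum_congr rfl fun ω _ => ?_
    by_cases h0 : p ω = 0
    · simp [h0]
    · have h1 := mass_pos hp V h0
      have h2 := mass_pos hp (fun ω => (V ω, g (Z ω))) h0
      rw [Real.logb_div (by positivity) h1.ne', Real.logb_mul hM.ne' h2.ne']
      ring
  -- The mean over `g` of the mass of a level set of `(V, g Z)`.
  have hmean : ∀ ω, ∑ g : β → Fin M, M * mass p (fun ω => (V ω, g (Z ω))) ω
      ≤ G * (mass p V ω + M * mass p (fun ω => (V ω, Z ω)) ω) := by
    intro ω
    have hcard : ∀ ω', Z ω' ≠ Z ω →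
        (∑ g : β → Fin M, if g (Z ω') = g (Z ω) then (1 : ℝ) else 0) * M ≤ G := by
      intro ω' h
      have := card_collision_le M h
      rw [Fintype.card_subtype] at this
      rw [Finset.sum_boole, hGdef]
      exact_mod_cast this
    calc _ = ∑ ω', ∑ g : β → Fin M,
          (if V ω' = V ω then p ω' else 0) * ((if g (Z ω') = g (Z ω) then (1 : ℝ) else 0) * M) := by
          rw [Finset.sum_comm]
          refine Finset.sum_congr rfl fun g _ => ?_
          rw [mass, Finset.mul_sum]
          refine Finset.sum_congr rfl fun ω' _ => ?_
          by_cases h1 : V ω' = V ω <;> by_cases h2 : g (Z ω') = g (Z ω) <;>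
            simp [h1, h2, mul_comm]
      _ ≤ ∑ ω', G * ((if V ω' = V ω then p ω' else 0)
            + M * (if (V ω', Z ω') = (V ω, Z ω) then p ω' else 0)) := by
          refine Finset.sum_le_sum fun ω' _ => ?_
          rw [← Finset.mul_sum, ← Finset.sum_mul]
          by_cases h1 : V ω' = V ω
          · by_cases h2 : Z ω' = Z ω
            · have : ∑ g : β → Fin M, (if g (Z ω') = g (Z ω) then (1 : ℝ) else 0) = G := by
                simp [h2, hGdef]
              rw [this, if_pos h1, if_pos (by rw [h1, h2])]
              nlinarith [hp ω']
            · rw [if_pos h1, if_neg (by simp [h2])]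
              nlinarith [hp ω', mul_le_mul_of_nonneg_left (hcard ω' h2) (hp ω')]
          · simp [h1]
      _ = _ := by
          rw [← Finset.mul_sum, Finset.sum_add_distrib, ← Finset.mul_sum]
          unfold mass
          congr!
  have hpt : ∀ ω, p ω ≠ 0 →
      ∑ g : β → Fin M, Real.logb 2 (M * mass p (fun ω => (V ω, g (Z ω))) ω / mass p V ω)
        ≤ G * Real.logb 2 (1 + M * (mass p (fun ω => (V ω, Z ω)) ω / mass p V ω)) := by
    intro ω h0
    have hV := mass_pos hp V h0
    have hVZ := mass_pos hp (fun ω => (V ω, Z ω)) h0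
    have hg : ∀ g : β → Fin M, 0 < mass p (fun ω => (V ω, g (Z ω))) ω := fun g => mass_pos hp _ h0
    set c := 1 + M * (mass p (fun ω => (V ω, Z ω)) ω / mass p V ω) with hc
    have hc0 : 0 < c := by positivity
    have hcV : c * mass p V ω = mass p V ω + M * mass p (fun ω => (V ω, Z ω)) ω := by
      rw [hc]; field_simp
    have key := sum_mul_logb_nonpos (Ω := β → Fin M) (p := fun _ => G⁻¹)
      (x := fun g => M * mass p (fun ω => (V ω, g (Z ω))) ω / mass p V ω / c)
      (fun _ => by positivity) (by simp [hGdef]) (fun g _ => by have := hg g; positivity) (by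
        rw [← Finset.mul_sum, ← Finset.sum_div, ← Finset.sum_div, inv_mul_le_iff₀ hG, mul_one,
          div_div, div_le_iff₀ (by positivity), mul_comm (mass p V ω), hcV]
        exact hmean ω)
    have h2 : ∀ g : β → Fin M,
        Real.logb 2 (M * mass p (fun ω => (V ω, g (Z ω))) ω / mass p V ω / c)
          = Real.logb 2 (M * mass p (fun ω => (V ω, g (Z ω))) ω / mass p V ω)
            - Real.logb 2 c := fun g =>
      Real.logb_div (by have := hg g; positivity) hc0.ne'
    simp only [h2] at key
    rw [← Finset.mul_sum, Finset.sum_sub_distrib, Finset.sum_const, Finset.card_univ,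
      nsmul_eq_mul, ← hGdef] at key
    have := nonpos_of_mul_nonpos_right key (inv_pos.2 hG)
    linarith
  obtain ⟨g, -, hg⟩ := Finset.exists_le_of_sum_le (s := (Finset.univ : Finset (β → Fin M)))
    (f := fun g => Real.logb 2 M - (ent p (fun ω => (V ω, g (Z ω))) - ent p V))
    (g := fun _ =>
      ∑ ω, p ω * Real.logb 2 (1 + M * (mass p (fun ω => (V ω, Z ω)) ω / mass p V ω)))
    Finset.univ_nonempty (by
      simp only [hD]
      rw [Finset.sum_comm, Finset.sum_const, Finset.card_univ, nsmul_eq_mul, ← hGdef,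
        Finset.mul_sum]
      refine Finset.sum_le_sum fun ω _ => ?_
      rw [← Finset.mul_sum]
      by_cases h0 : p ω = 0
      · simp [h0]
      · rw [mul_left_comm]
        exact mul_le_mul_of_nonneg_left (hpt ω h0) (hp ω))
  exact ⟨g, hg⟩

end Hash

section Truncation

universe u

variable {N : Type u} [Fintype N] [DecidableEq N]

namespace Model

/-- The information `-log P(ξ_z | all other variables)`. -/
noncomputable def condInfo (m : Model N) (z : N) (ω : m.Ω) : ℝ :=
  Real.logb 2 (mass m.p (m.vars (Finset.univ.erase z)) ω)
    - Real.logb 2 (mass m.p (m.vars Finset.univ) ω)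

/-- The conditional entropy of `ξ_z` given all other variables. -/
noncomputable def condEnt (m : Model N) (z : N) : ℝ :=
  m.profile Finset.univ - m.profile (Finset.univ.erase z)

/-- The variance of the information `condInfo`. -/
noncomputable def condVar (m : Model N) (z : N) : ℝ :=
  ∑ ω, m.p ω * (m.condInfo z ω - m.condEnt z) ^ 2

theorem sum_mul_condInfo (m : Model N) (z : N) :
    ∑ ω, m.p ω * (m.condInfo z ω - m.condEnt z) = 0 := by
  have h : ∑ ω, m.p ω * m.condInfo z ω = m.condEnt z := by
    rw [condEnt, profile, profile, ent, ent, ← Finset.sum_sub_distrib]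
    exact Finset.sum_congr rfl fun ω _ => by rw [condInfo]; ring
  simp only [mul_sub, Finset.sum_sub_distrib, h, ← Finset.sum_mul, m.sum_eq, one_mul, sub_self]

theorem condEnt_nonneg (m : Model N) (z : N) : 0 ≤ m.condEnt z :=
  sub_nonneg.2 (m.profile_mono (Finset.subset_univ _))

theorem condVar_prod (m m' : Model N) (z : N) :
    (m.prod m').condVar z = m.condVar z + m'.condVar z := by
  rw [condVar, condVar, condVar, ← sum_prod_mul_add_sq m.sum_eq m'.sum_eq (m.sum_mul_condInfo z)]
  have hmass : ∀ (A : Finset N) (x : m.Ω × m'.Ω),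
      mass (m.prod m').p ((m.prod m').vars A) x
        = mass m.p (m.vars A) x.1 * mass m'.p (m'.vars A) x.2 := fun A x =>
    (mass_congr fun y _ => prod_vars_eq_iff m m').trans (mass_prod _ _ _ _ _)
  refine Finset.sum_congr rfl fun (x : m.Ω × m'.Ω) _ => ?_
  change m.p x.1 * m'.p x.2 * _ = _
  by_cases h1 : m.p x.1 = 0
  · simp [h1]
  by_cases h2 : m'.p x.2 = 0
  · simp [h2]
  have h3 := fun A => (mass_pos m.nonneg (m.vars A) h1).ne'
  have h4 := fun A => (mass_pos m'.nonneg (m'.vars A) h2).ne'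
  have hinfo : (m.prod m').condInfo z x = m.condInfo z x.1 + m'.condInfo z x.2 := by
    change Real.logb 2 (mass (m.prod m').p ((m.prod m').vars _) x)
      - Real.logb 2 (mass (m.prod m').p ((m.prod m').vars _) x) = _
    rw [hmass, hmass, Real.logb_mul (h3 _) (h4 _), Real.logb_mul (h3 _) (h4 _), condInfo, condInfo]
    ring
  rw [hinfo, condEnt, condEnt, condEnt, profile_prod, profile_prod]
  ring

/-- Independent copies of a family: entropies and the variance of the information are
multiplied by the number of copies. -/
theorem exists_power (m : Model N) (z : N) (n : ℕ) :
    ∃ m' : Model N, (∀ A, m'.profile A = ((n : ℝ) + 1) * m.profile A) ∧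
      m'.condVar z = ((n : ℝ) + 1) * m.condVar z := by
  induction n with
  | zero => exact ⟨m, by simp, by simp⟩
  | succ n ih =>
    obtain ⟨m', h1, h2⟩ := ih
    refine ⟨m'.prod m, fun A => ?_, ?_⟩
    · rw [profile_prod, h1]; push_cast; ring
    · rw [condVar_prod, h2]; push_cast; ring

/-- Conditioning on a hash of `ξ_z` of about `condEnt` bits: it is almost independent of the
other variables, and together with them it almost determines `ξ_z`. The parameter `s` stands for
the expected size of the deviation of the information from its mean. -/
theorem exists_isAent_near (m : Model N) (z : N) {s : ℝ} (hs : 0 < s) :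
    ∃ g : Finset N → ℝ, IsAent g ∧
      ∀ A, |g A - (m.profile A - if z ∈ A then m.condEnt z else 0)|
        ≤ 2 + s + m.condVar z / s := by
  set h := m.condEnt z with hh
  set V := m.vars (Finset.univ.erase z) with hV
  -- At least half of `2 ^ h`, so the rounding costs at most one bit.
  set M := ⌊(2 : ℝ) ^ h⌋₊ with hM
  have h1 : (1 : ℝ) ≤ 2 ^ h := Real.one_le_rpow (by norm_num) (m.condEnt_nonneg z)
  have hM1 : 1 ≤ M := Nat.le_floor (by simpa using h1)
  have : NeZero M := ⟨by omega⟩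
  have hM1' : (1 : ℝ) ≤ M := by exact_mod_cast hM1
  have hMle : (M : ℝ) ≤ 2 ^ h := Nat.floor_le (by positivity)
  have hMge : (2 : ℝ) ^ h < M + 1 := Nat.lt_floor_add_one _
  have hlogle : Real.logb 2 M ≤ h := by
    rw [Real.logb_le_iff_le_rpow (by norm_num) (by linarith)]
    exact hMle
  have hlogge : h - 1 ≤ Real.logb 2 M := by
    rw [Real.le_logb_iff_rpow_le (by norm_num) (by linarith), Real.rpow_sub_one (by norm_num)]
    linarith
  obtain ⟨φ, hφ⟩ := exists_hash m.nonneg m.sum_eq V (m.ξ z) M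
  set w : m.Ω → Fin M := fun ω => φ (m.ξ z ω) with hw
  have hdev : ∑ ω, m.p ω * Real.logb 2 (1 + M * (mass m.p (fun ω => (V ω, m.ξ z ω)) ω
      / mass m.p V ω)) ≤ 1 + s + m.condVar z / s := by
    calc _ ≤ ∑ ω, (m.p ω * (1 + s) + m.p ω * (m.condInfo z ω - h) ^ 2 / s) := by
          refine Finset.sum_le_sum fun ω _ => ?_
          by_cases h0 : m.p ω = 0
          · simp [h0]
          rw [mul_div_assoc, ← mul_add]
          refine mul_le_mul_of_nonneg_left ?_ (m.nonneg ω)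
          have e : mass m.p (fun ω => (V ω, m.ξ z ω)) ω = mass m.p (m.vars Finset.univ) ω := by
            refine mass_congr fun ω' _ => ?_
            rw [Prod.mk.injEq, hV, vars_eq_iff, vars_eq_iff]
            refine ⟨fun hx i _ => ?_, fun hx => ⟨fun i _ => hx i (by simp), hx z (by simp)⟩⟩
            by_cases hi : i = z
            · exact hi ▸ hx.2
            · exact hx.1 i (by simp [hi])
          have hVpos := mass_pos m.nonneg V h0
          have hUpos := mass_pos m.nonneg (m.vars Finset.univ) h0
          have e2 : mass m.p (m.vars Finset.univ) ω / mass m.p V ω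
              = 2 ^ (-m.condInfo z ω) := by
            rw [condInfo, neg_sub, Real.rpow_sub (by norm_num),
              Real.rpow_logb (by norm_num) (by norm_num) hUpos,
              Real.rpow_logb (by norm_num) (by norm_num) hVpos]
          -- As `M ≤ 2 ^ h`, the logarithm is at most one bit plus the deviation of the information.
          rw [e, e2]
          set t := |m.condInfo z ω - h| with ht
          have h3 : 1 + M * (2 : ℝ) ^ (-m.condInfo z ω) ≤ 2 ^ (1 + t) := by
            have h4 : M * (2 : ℝ) ^ (-m.condInfo z ω) ≤ 2 ^ t := by
              calc _ ≤ (2 : ℝ) ^ h * 2 ^ (-m.condInfo z ω) := by gcongr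
                _ = 2 ^ (h - m.condInfo z ω) := by
                  rw [← Real.rpow_add (by norm_num), sub_eq_add_neg]
                _ ≤ 2 ^ t := by
                  refine Real.rpow_le_rpow_of_exponent_le (by norm_num) ?_
                  rw [ht, abs_sub_comm]
                  exact le_abs_self _
            have h5 : (1 : ℝ) ≤ 2 ^ t := Real.one_le_rpow (by norm_num) (abs_nonneg _)
            rw [Real.rpow_add (by norm_num), Real.rpow_one]
            linarith
          have h6 : Real.logb 2 (1 + M * (2 : ℝ) ^ (-m.condInfo z ω)) ≤ 1 + t := by
            rw [Real.logb_le_iff_le_rpow (by norm_num) (by positivity)]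
            exact h3
          -- Linearised form of the Cauchy–Schwarz bound of the mean deviation by the variance.
          have h7 : t ≤ s + (m.condInfo z ω - h) ^ 2 / s := by
            rw [← sq_abs, ← ht, ← sub_le_iff_le_add', le_div_iff₀ hs]
            nlinarith [sq_nonneg (t - s), abs_nonneg (m.condInfo z ω - h)]
          linarith
      _ = _ := by
          rw [Finset.sum_add_distrib, ← Finset.sum_mul, m.sum_eq, ← Finset.sum_div, condVar]
          ring
  have e1 := hφ.trans hdev
  have e2 : ent m.p w ≤ Real.logb 2 M := by
    have : Nonempty (Fin M) := ⟨0⟩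
    simpa using ent_le_logb_card m.nonneg m.sum_eq w
  have e3 := ent_pair_le m.nonneg m.sum_eq V w
  change Real.logb 2 M - (ent m.p (fun ω => (V ω, w ω)) - ent m.p V) ≤ _ at e1
  have hvar : 0 ≤ m.condVar z / s :=
    div_nonneg (Finset.sum_nonneg fun ω _ => mul_nonneg (m.nonneg ω) (sq_nonneg _)) hs.le
  refine ⟨_, m.isAent_cond w, fun A => ?_⟩
  by_cases hz : z ∈ A
  · -- The hash is a function of `ξ_A`.
    have e4 : ent m.p (fun ω => (m.vars A ω, w ω)) = m.profile A := by
      refine ent_congr fun ω ω' _ _ => ?_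
      rw [Prod.mk.injEq, and_iff_left_iff_imp]
      intro hx
      rw [hw]
      exact congrArg φ ((m.vars_eq_iff.1 hx) z hz)
    rw [if_pos hz, e4, abs_le]
    constructor <;> linarith
  · -- `ξ_A` is a function of `V`, so the hash is at least as uniform given `ξ_A`.
    have e4 := ent_pair_le m.nonneg m.sum_eq (m.vars A) w
    have e5 := condEnt_antitone m.nonneg m.sum_eq (φ := m.vars A) (ψ := V) w fun ω ω' => by
      rw [hV, vars_eq_iff, vars_eq_iff]
      exact fun hx i hi => hx i (Finset.mem_erase.2 ⟨fun h' => hz (h' ▸ hi), by simp⟩)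
    rw [if_neg hz, abs_le, profile]
    constructor <;> linarith

/-- The conditional entropy of one variable given all the others can be removed from it: the
case in which `z` is to become a function of everything else. -/
theorem isAent_truncate (m : Model N) (z : N) :
    IsAent fun A => m.profile A - if z ∈ A then m.condEnt z else 0 := by
  choose P hP hPv using fun n : ℕ => m.exists_power z n
  have hk : ∀ n : ℕ, (0 : ℝ) < (n : ℝ) + 1 := fun n => by positivity
  -- With `n` copies the standard deviation is of order `√n`, the best choice of the parameter `s`.
  choose g hg hgA using fun n : ℕ => (P n).exists_isAent_near z (Real.sqrt_pos.2 (hk n))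
  have hc : ∀ n : ℕ, (P n).condEnt z = ((n : ℝ) + 1) * m.condEnt z := fun n => by
    rw [condEnt, condEnt, hP, hP]; ring
  refine isClosed_closure.mem_of_tendsto (f := fun n : ℕ => ((n : ℝ) + 1)⁻¹ • g n)
    (b := Filter.atTop) ?_ (Filter.Eventually.of_forall fun n =>
      (hg n).smul (inv_nonneg.2 (hk n).le) (inv_le_one_of_one_le₀ (by simp)))
  refine tendsto_pi_nhds.2 fun A => ?_
  rw [tendsto_iff_dist_tendsto_zero]
  have htop : Filter.Tendsto (fun n : ℕ => (n : ℝ) + 1) Filter.atTop Filter.atTop :=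
    Filter.tendsto_atTop_add_const_right _ _ tendsto_natCast_atTop_atTop
  have hlim : Filter.Tendsto (fun n : ℕ => 2 / ((n : ℝ) + 1)
      + (1 + m.condVar z) / √((n : ℝ) + 1)) Filter.atTop (nhds 0) := by
    rw [← add_zero (0 : ℝ)]
    exact (tendsto_const_nhds.div_atTop htop).add
      (tendsto_const_nhds.div_atTop (Real.tendsto_sqrt_atTop.comp htop))
  refine squeeze_zero (fun _ => dist_nonneg) (fun n => ?_) hlim
  have hsq : √((n : ℝ) + 1) * √((n : ℝ) + 1) = (n : ℝ) + 1 := Real.mul_self_sqrt (hk n).le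
  have hsp := Real.sqrt_pos.2 (hk n)
  have e : ((n : ℝ) + 1)⁻¹ * g n A - (m.profile A - if z ∈ A then m.condEnt z else 0)
      = ((n : ℝ) + 1)⁻¹ * (g n A - ((P n).profile A - if z ∈ A then (P n).condEnt z else 0)) := by
    rw [hP, hc]
    have := (hk n).ne'
    split_ifs <;> field_simp
    ring
  rw [Real.dist_eq, Pi.smul_apply, smul_eq_mul, e, abs_mul, abs_of_pos (inv_pos.2 (hk n))]
  refine (mul_le_mul_of_nonneg_left (hgA n A) (inv_pos.2 (hk n)).le).trans_eq ?_
  rw [hPv]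
  generalize √((n : ℝ) + 1) = r at hsq hsp
  rw [← hsq]
  field_simp
  ring

end Model

end Truncation

/-! ### Conditionally independent gluing -/

section Gluing

universe u

variable {N : Type u}

namespace Model

open Classical in
/-- The weights, on pairs of sample points, of two copies of the family that coincide on the
variables in `S` and are conditionally independent given those. -/
noncomputable def glueWeight (m : Model N) (S : Finset N) (x : m.Ω × m.Ω) : ℝ :=
  if m.vars S x.1 = m.vars S x.2 then m.p x.1 * m.p x.2 / mass m.p (m.vars S) x.1 else 0

theorem glueWeight_nonneg (m : Model N) (S : Finset N) (x : m.Ω × m.Ω) :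
    0 ≤ m.glueWeight S x := by
  rw [glueWeight]
  split_ifs
  · exact div_nonneg (mul_nonneg (m.nonneg _) (m.nonneg _)) (mass_nonneg m.nonneg _ _)
  · exact le_rfl

theorem glueWeight_swap (m : Model N) (S : Finset N) (x : m.Ω × m.Ω) :
    m.glueWeight S x.swap = m.glueWeight S x := by
  rw [glueWeight, glueWeight]
  by_cases h : m.vars S x.1 = m.vars S x.2
  · rw [if_pos h, if_pos (by exact h.symm), mul_comm]
    congr 1
    exact (mass_eq_of_eq h).symm
  · rw [if_neg h, if_neg fun h' => h h'.symm]

theorem sum_glueWeight_left (m : Model N) (S : Finset N) (ω : m.Ω) :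
    ∑ ω', m.glueWeight S (ω, ω') = m.p ω := by
  classical
  by_cases h0 : m.p ω = 0
  · simp [glueWeight, h0]
  set c := mass m.p (m.vars S) ω with hc
  have hm : c ≠ 0 := (mass_pos m.nonneg (m.vars S) h0).ne'
  calc _ = m.p ω / c * c := by
        conv_rhs => enter [2]; rw [hc, mass]
        rw [Finset.mul_sum]
        refine Finset.sum_congr rfl fun ω' _ => ?_
        by_cases h : m.vars S ω = m.vars S ω'
        · rw [glueWeight, if_pos h, if_pos h.symm]
          change m.p ω * m.p ω' / c = m.p ω / c * m.p ω'
          ring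
        · rw [glueWeight, if_neg h, if_neg fun h' => h h'.symm, mul_zero]
    _ = m.p ω := div_mul_cancel₀ _ hm

/-- The first copy has the original law. -/
theorem glueWeight_map_fst (m : Model N) (S : Finset N) [DecidableEq m.Ω] (ω : m.Ω) :
    ∑ x : m.Ω × m.Ω with x.1 = ω, m.glueWeight S x = m.p ω := by
  rw [← m.sum_glueWeight_left S ω, Finset.sum_filter, Fintype.sum_prod_type,
    Finset.sum_eq_single ω]
  · simp
  · intro ω' _ h
    simp [h]
  · simp

/-- The second copy has the original law. -/
theorem glueWeight_map_snd (m : Model N) (S : Finset N) [DecidableEq m.Ω] (ω : m.Ω) :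
    ∑ x : m.Ω × m.Ω with x.2 = ω, m.glueWeight S x = m.p ω := by
  rw [← m.glueWeight_map_fst S ω]
  refine Finset.sum_equiv (Equiv.prodComm _ _) (by simp) fun x _ => ?_
  exact (m.glueWeight_swap S x).symm

/-- The variable at `z` is taken from the first copy, all others from the second: this makes
`ξ_z` conditionally independent of the other variables given `ξ_S`. -/
noncomputable def glue [DecidableEq N] (m : Model N) (S : Finset N) (z : N) : Model N where
  Ω := m.Ω × m.Ω
  p := m.glueWeight S
  nonneg := m.glueWeight_nonneg S
  sum_eq := by
    rw [Fintype.sum_prod_type]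
    simp only [sum_glueWeight_left, m.sum_eq]
  X := m.X
  ξ i x := if i = z then m.ξ i x.1 else m.ξ i x.2

theorem vars_eq_of_glueWeight_ne_zero {m : Model N} {S : Finset N} {x : m.Ω × m.Ω}
    (h : m.glueWeight S x ≠ 0) : m.vars S x.1 = m.vars S x.2 := by
  by_contra h'
  exact h (if_neg h')

variable [DecidableEq N]

theorem glue_vars_eq_iff (m : Model N) (S : Finset N) (z : N) {A : Finset N}
    {x x' : (m.glue S z).Ω} : (m.glue S z).vars A x' = (m.glue S z).vars A x ↔
      (z ∈ A → m.ξ z x'.1 = m.ξ z x.1) ∧ m.vars (A.erase z) x'.2 = m.vars (A.erase z) x.2 := by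
  rw [vars_eq_iff, vars_eq_iff]
  constructor
  · refine fun h => ⟨fun hz => by simpa [glue] using h z hz, fun i hi => ?_⟩
    simpa [glue, Finset.ne_of_mem_erase hi] using h i (Finset.mem_of_mem_erase hi)
  · rintro ⟨h1, h2⟩ i hi
    by_cases hz : i = z
    · subst hz
      simpa [glue] using h1 hi
    · simpa [glue, hz] using h2 i (Finset.mem_erase.2 ⟨hz, hi⟩)

theorem profile_glue_of_notMem (m : Model N) (S : Finset N) {z : N} {A : Finset N} (hA : z ∉ A) :
    (m.glue S z).profile A = m.profile A := by
  classical
  refine Eq.trans ?_ (ent_comp (m.glueWeight_map_snd S) (m.vars A))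
  refine ent_congr fun x x' _ _ => (m.glue_vars_eq_iff S z).trans ?_
  rw [Finset.erase_eq_of_notMem hA]
  exact and_iff_right fun h => absurd h hA

theorem profile_glue_of_subset (m : Model N) {S : Finset N} {z : N} {A : Finset N}
    (hA : A ⊆ insert z S) : (m.glue S z).profile A = m.profile A := by
  classical
  refine Eq.trans ?_ (ent_comp (m.glueWeight_map_fst S) (m.vars A))
  refine ent_congr fun x x' hx hx' => (m.glue_vars_eq_iff S z).trans ?_
  change _ ↔ m.vars A x'.1 = m.vars A x.1
  rw [vars_eq_iff, vars_eq_iff]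
  have e : ∀ i ∈ A, i ≠ z → (m.ξ i x'.2 = m.ξ i x.2 ↔ m.ξ i x'.1 = m.ξ i x.1) := by
    intro i hi hz
    have hiS : i ∈ S := (Finset.mem_insert.1 (hA hi)).resolve_left hz
    rw [m.vars_eq_iff.1 (vars_eq_of_glueWeight_ne_zero hx) i hiS,
      m.vars_eq_iff.1 (vars_eq_of_glueWeight_ne_zero hx') i hiS]
  constructor
  · rintro ⟨h1, h2⟩ i hi
    by_cases hz : i = z
    · subst hz
      exact h1 hi
    · exact (e i hi hz).1 (h2 i (Finset.mem_erase.2 ⟨hz, hi⟩))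
  · intro h
    refine ⟨h z, fun i hi => ?_⟩
    have hi' := Finset.mem_of_mem_erase hi
    exact (e i hi' (Finset.ne_of_mem_erase hi)).2 (h i hi')

/-- Conditional independence of `ξ_z` and the remaining variables given `ξ_S`, after gluing. -/
theorem profile_glue_univ [Fintype N] (m : Model N) {S : Finset N} {z : N} (hz : z ∉ S) :
    (m.glue S z).profile Finset.univ
      = m.profile (insert z S) + m.profile (Finset.univ.erase z) - m.profile S := by
  classical
  let R : Finset N := Finset.univ.erase z
  have hSR : ∀ {ω ω' : m.Ω}, m.vars R ω = m.vars R ω' → m.vars S ω = m.vars S ω' := by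
    intro ω ω' h
    rw [vars_eq_iff] at h ⊢
    exact fun i hi => h i (Finset.mem_erase.2 ⟨fun h' => hz (h' ▸ hi), by simp⟩)
  have hTS : ∀ {ω ω' : m.Ω}, m.vars (insert z S) ω = m.vars (insert z S) ω' →
      m.vars S ω = m.vars S ω' := by
    intro ω ω' h
    rw [vars_eq_iff] at h ⊢
    exact fun i hi => h i (Finset.mem_insert_of_mem hi)
  -- On the support, the joint law has the product form of conditional independence.
  have hmass : ∀ x : m.Ω × m.Ω, m.glueWeight S x ≠ 0 →
      mass (m.glue S z).p ((m.glue S z).vars Finset.univ) x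
        = mass m.p (m.vars (insert z S)) x.1 * mass m.p (m.vars R) x.2
          / mass m.p (m.vars S) x.1 := by
    intro x hx
    have hxS := vars_eq_of_glueWeight_ne_zero hx
    set c := mass m.p (m.vars S) x.1 with hc
    rw [← mass_prod, mass, Finset.sum_div]
    refine Finset.sum_congr rfl fun (x' : m.Ω × m.Ω) _ => ?_
    have hp : (m.glue S z).p x' = m.glueWeight S x' := rfl
    rw [hp]
    have hiff : (m.vars S x'.1 = m.vars S x'.2 ∧
        (m.glue S z).vars Finset.univ x' = (m.glue S z).vars Finset.univ x) ↔
        (m.vars (insert z S) x'.1, m.vars R x'.2) = (m.vars (insert z S) x.1, m.vars R x.2) := by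
      have hL : (m.glue S z).vars Finset.univ x' = (m.glue S z).vars Finset.univ x ↔
          m.ξ z x'.1 = m.ξ z x.1 ∧ m.vars R x'.2 = m.vars R x.2 :=
        (m.glue_vars_eq_iff S z).trans (and_congr_left' (by simp))
      have hI : ∀ ω ω' : m.Ω, m.vars (insert z S) ω = m.vars (insert z S) ω' ↔
          m.ξ z ω = m.ξ z ω' ∧ m.vars S ω = m.vars S ω' := by
        intro ω ω'
        simp [vars_eq_iff]
      rw [hL, Prod.mk.injEq, hI]
      constructor
      · rintro ⟨h1, h2, h3⟩
        exact ⟨⟨h2, h1.trans ((hSR h3).trans hxS.symm)⟩, h3⟩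
      · rintro ⟨⟨h1, h2⟩, h3⟩
        exact ⟨h2.trans (hxS.trans (hSR h3).symm), h1, h3⟩
    by_cases hR : (m.vars (insert z S) x'.1, m.vars R x'.2)
        = (m.vars (insert z S) x.1, m.vars R x.2)
    · obtain ⟨h1, h2⟩ := hiff.2 hR
      rw [if_pos h2, if_pos hR, glueWeight, if_pos h1, hc,
        mass_eq_of_eq (hTS (Prod.mk.inj hR).1)]
    · rw [if_neg hR, zero_div]
      by_cases h2 : (m.glue S z).vars Finset.univ x' = (m.glue S z).vars Finset.univ x
      · rw [if_pos h2, glueWeight, if_neg fun h1 => hR (hiff.1 ⟨h1, h2⟩)]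
      · rw [if_neg h2]
  have hl : ∀ A : Finset N, m.profile A
      = ∑ x, m.glueWeight S x * -Real.logb 2 (mass m.p (m.vars A) x.1) := fun A =>
    (sum_comp (m.glueWeight_map_fst S) fun ω => -Real.logb 2 (mass m.p (m.vars A) ω)).symm
  have hr : ∀ A : Finset N, m.profile A
      = ∑ x, m.glueWeight S x * -Real.logb 2 (mass m.p (m.vars A) x.2) := fun A =>
    (sum_comp (m.glueWeight_map_snd S) fun ω => -Real.logb 2 (mass m.p (m.vars A) ω)).symm
  rw [hl (insert z S), hl S, hr (Finset.univ.erase z), ← Finset.sum_add_distrib,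
    ← Finset.sum_sub_distrib]
  refine Finset.sum_congr rfl fun (x : m.Ω × m.Ω) _ => ?_
  change m.glueWeight S x * _ = _
  by_cases hx : m.glueWeight S x = 0
  · simp [hx]
  have h1 : m.p x.1 ≠ 0 := fun h => hx (by simp [glueWeight, h])
  have h2 : m.p x.2 ≠ 0 := fun h => hx (by simp [glueWeight, h])
  have p1 := (mass_pos m.nonneg (m.vars (insert z S)) h1).ne'
  have p2 := (mass_pos m.nonneg (m.vars S) h1).ne'
  have p3 := (mass_pos m.nonneg (m.vars R) h2).ne'
  rw [hmass x hx, Real.logb_div (mul_ne_zero p1 p3) p2, Real.logb_mul p1 p3]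
  ring

end Model

end Gluing

/-! ### Passage to the limit -/

section Limit

variable {N : Type*} [Fintype N] [DecidableEq N]

theorem IsAent.mono {f : Finset N → ℝ} (hf : IsAent f) {A B : Finset N} (h : A ⊆ B) :
    f A ≤ f B := by
  refine closure_minimal (t := {f : Finset N → ℝ | f A ≤ f B}) ?_
    (isClosed_le (continuous_apply A) (continuous_apply B)) hf
  intro g hg
  obtain ⟨m, rfl⟩ := isEntropic_iff_exists_model.1 hg
  exact m.profile_mono h

/-- The statement for an entropic function. The value at the whole index set is recorded since
it bounds the function that is constructed. -/
theorem IsEntropic.exists_isAent {f : Finset N → ℝ} (hf : IsEntropic f) {Y : Finset N} {z : N}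
    (hz : z ∉ Y) :
    ∃ g : Finset N → ℝ, IsAent g ∧ (∀ A, z ∉ A → g A = f A) ∧
      (∀ A, z ∈ A → A ⊆ Y ∪ {z} → g A = f A - condRank f {z} Y) ∧
      g Finset.univ = f (Finset.univ.erase z) := by
  obtain ⟨m, rfl⟩ := isEntropic_iff_exists_model.1 hf
  have hr : (m.glue Y z).profile (Finset.univ.erase z) = m.profile (Finset.univ.erase z) :=
    m.profile_glue_of_notMem Y (by simp)
  have hc : (m.glue Y z).condEnt z = condRank m.profile {z} Y := by
    rw [Model.condEnt, m.profile_glue_univ hz, hr, condRank, ← Finset.insert_eq]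
    ring
  refine ⟨_, (m.glue Y z).isAent_truncate z, fun A hA => ?_, fun A hA hAY => ?_, ?_⟩
  · rw [if_neg hA, sub_zero, m.profile_glue_of_notMem Y hA]
  · rw [if_pos hA, hc, m.profile_glue_of_subset (by rwa [Finset.insert_eq, Finset.union_comm])]
  · rw [if_pos (Finset.mem_univ z), Model.condEnt, sub_sub_cancel, hr]

end Limit

end EntropyRegion

theorem mainTheorem6 {N : Type*} [Fintype N] [DecidableEq N] (X Y : Finset N) (z : N)
    (hXY : Disjoint X Y) (hzX : z ∉ X) (hzY : z ∉ Y) (hN : X ∪ Y ∪ {z} = Finset.univ)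
    (f : Finset N → ℝ) (hf : EntropyRegion.IsAent f) :
    ∃ fstar : Finset N → ℝ, EntropyRegion.IsAent fstar ∧
      (∀ A : Finset N, z ∉ A → fstar A = f A) ∧
      (∀ A : Finset N, z ∈ A → A ⊆ Y ∪ {z} →
        fstar A = f A - EntropyRegion.condRank f {z} Y) := by
  obtain ⟨u, hu, hlim⟩ := mem_closure_iff_seq_limit.1 hf
  have hlimA : ∀ A, Filter.Tendsto (fun k => u k A) Filter.atTop (nhds (f A)) :=
    tendsto_pi_nhds.1 hlim
  -- The functions built for the approximants of `f` all lie in the box `[0, C]`.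
  choose g hg hgz hgY hgN using fun k =>
    EntropyRegion.IsEntropic.exists_isAent (hu k) hzY
  obtain ⟨C, hC⟩ := (hlimA (Finset.univ.erase z)).bddAbove_range
  have hbd : ∀ k, g k ∈ Set.Icc (0 : Finset N → ℝ) fun _ => C := by
    refine fun k => ⟨fun A => ?_, fun A => ?_⟩
    · have := (hg k).mono (Finset.empty_subset A)
      rwa [(hg k).empty] at this
    · exact ((hg k).mono (Finset.subset_univ A)).trans ((hgN k).trans_le (hC ⟨k, rfl⟩))
  obtain ⟨F, -, θ, hθ, hF⟩ := isCompact_Icc.tendsto_subseq hbd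
  have hFA : ∀ A, Filter.Tendsto (fun k => g (θ k) A) Filter.atTop (nhds (F A)) :=
    tendsto_pi_nhds.1 hF
  have hlimθ : ∀ A, Filter.Tendsto (fun k => u (θ k) A) Filter.atTop (nhds (f A)) := fun A =>
    (hlimA A).comp hθ.tendsto_atTop
  refine ⟨F, isClosed_closure.mem_of_tendsto hF (Filter.Eventually.of_forall fun k => hg (θ k)),
    fun A hA => ?_, fun A hA hAY => ?_⟩
  · refine tendsto_nhds_unique (hFA A) ?_
    simpa only [hgz _ A hA] using hlimθ A
  · refine tendsto_nhds_unique (hFA A) ?_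
    simpa only [hgY _ A hA hAY, EntropyRegion.condRank] using
      (hlimθ A).sub ((hlimθ ({z} ∪ Y)).sub (hlimθ Y))
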